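/- Work in the standard model of floating-point arithmetic with machine precision $u\ge 0$: every elementary operation $+,-,\times,/,\sqrt{\cdot}$ with exact result $x$ returns $x(1+\delta)$ for some $|\delta|\le u$ (no underflow or overflow). For a positive integer $k$ with $ku<1$ put $\gamma_k(u)=\frac{ku}{1-ku}$. For matrices, $|M|$ is the matrix of absolute values of the entries, inequalities between matrices are entrywise, and $\|\cdot\|_2$ is the spectral norm. Let $A=\begin{pmatrix}A_{11}&A_{12}\\A_{12}^T&A_{22}\end{pmatrix}\in\mathbb R^{2n\times 2n}$ be symmetric positive definite, with $n\times n$ blocks. Algorithm $W_2$ computes (1) the Cholesky factorization $A_{11}=L_{11}L_{11}^T$, with $L_{11}$ lower triangular; (2) $L_{21}$ from $L_{11}L_{21}^T=A_{12}$ by forward substitution; (3) the Schur complement $S=A_{22}-L_{21}L_{21}^T$, by forming the product by inner products and then subtracting it from $A_{22}$; (4) the reverse Cholesky factorization $S=L_{22}L_{22}^T$, with $L_{22}$ upper triangular, that is, the Cholesky factorization after the order of rows and columns is reversed; and returns $L_2=\begin{pmatrix}L_{11}&0\\L_{21}&L_{22}\end{pmatrix}$. The sums that occur may be evaluated in any order.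 The algorithm runs to completion if all computed pivots, whose square roots are taken in the two Cholesky factorizations, are positive. **Theorem.** Suppose that $(n+1)u<1$ and that Algorithm $W_2$, applied to $A$ in floating-point arithmetic, runs to completion and returns $\tilde L_2$. Then there is a matrix $E\in\mathbb R^{2n\times 2n}$ with $$A+E=\tilde L_2\tilde L_2^T,\qquad |E|\le u|A|+\gamma_{n+1}(u)\,|\tilde L_2|\,|\tilde L_2^T| .$$ Moreover, if $(n+2)u<1$ and $4n\gamma_{n+2}(u)<1$, then $$\|A-\tilde L_2\tilde L_2^T\|_2=\|E\|_2\le 4n\,\gamma_{n+2}(u)\,\|A\|_2 .$$ -/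

import Mathlib

namespace FloatCholesky

/-- The standard model of floating-point arithmetic with machine precision `u`: `y` is an
admissible computed value of an elementary operation whose exact result is `x`,
that is, `y = x (1 + δ)` for some `δ` with `|δ| ≤ u`. -/
def Rounded (u x y : ℝ) : Prop :=
  ∃ δ : ℝ, |δ| ≤ u ∧ y = x * (1 + δ)

/-- `γ_k(u) = k u / (1 - k u)`, meaningful when `k u < 1`. -/
noncomputable def gamma (k : ℕ) (u : ℝ) : ℝ :=
  (k * u) / (1 - k * u)

/-- `FlSum u x s z`: `z` is a floating-point value of `∑ i ∈ s, x i`, for a nonempty `s`, obtained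
by pairwise floating-point additions in some order and bracketing, each `x i` with `i ∈ s`
entering exactly once. -/
inductive FlSum {ι : Type} [DecidableEq ι] (u : ℝ) (x : ι → ℝ) : Finset ι → ℝ → Prop
  | single (i : ι) : FlSum u x {i} (x i)
  | add {s t : Finset ι} {a b z : ℝ} (hst : Disjoint s t) (ha : FlSum u x s a)
      (hb : FlSum u x t b) (hz : Rounded u (a + b) z) : FlSum u x (s ∪ t) z

/-- `z` is a floating-point value of the inner product `∑ k, a k * b k` of two vectors: the
products are rounded and then summed in some order. -/
def FlDot {n : ℕ} (u : ℝ) (a b : Fin n → ℝ) (z : ℝ) : Prop :=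
  ∃ p : Fin n → ℝ, (∀ k, Rounded u (a k * b k) (p k)) ∧ FlSum u p Finset.univ z

/-- `z` is a floating-point value of `c - ∑ k ∈ s, a k * b k`: the products are rounded, and the
`s.card + 1` terms `c` and `-p k` are then added in some order.
The term `c` has the index `none`. -/
def FlSubDot {n : ℕ} (u c : ℝ) (s : Finset (Fin n)) (a b : Fin n → ℝ) (z : ℝ) : Prop :=
  ∃ p : Fin n → ℝ, (∀ k ∈ s, Rounded u (a k * b k) (p k)) ∧
    FlSum u (fun o : Option (Fin n) => o.elim c fun k => -p k) (Finset.insertNone s) z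

/-- Floating-point Cholesky factorization, reading the lower triangle of `A`, runs to completion
(every computed pivot `s`, whose square root is taken, is positive) and returns the lower
triangular matrix `L`:
`L j j = √(A j j - ∑ k < j, L j k ^ 2)` and
`L i j = (A i j - ∑ k < j, L i k * L j k) / L j j` for `j < i`, evaluated in floating point. -/
structure FlCholesky {n : ℕ} (u : ℝ) (A L : Matrix (Fin n) (Fin n) ℝ) : Prop where
  upper : ∀ i j, i < j → L i j = 0
  diag : ∀ j, ∃ s, FlSubDot u (A j j) (Finset.Iio j) (L j) (L j) s ∧ 0 < s ∧
    Rounded u (Real.sqrt s) (L j j)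
  lower : ∀ i j, j < i → ∃ s, FlSubDot u (A i j) (Finset.Iio j) (L i) (L j) s ∧
    Rounded u (s / L j j) (L i j)

/-- Floating-point reverse Cholesky factorization `A = U Uᵀ` with `U` upper triangular: the
Cholesky factorization of `Pᵀ A P = (Pᵀ U P) (Pᵀ U P)ᵀ`, where `P` is the permutation matrix
that reverses the order of the indices. -/
def FlReverseCholesky {n : ℕ} (u : ℝ) (A U : Matrix (Fin n) (Fin n) ℝ) : Prop :=
  FlCholesky u (A.submatrix Fin.rev Fin.rev) (U.submatrix Fin.rev Fin.rev)

/-- Floating-point forward substitution for `L X = Y`, with `L` lower triangular, returns `X`: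
`X i j = (Y i j - ∑ k < i, L i k * X k j) / L i i`, evaluated in floating point. -/
def FlForwardSubst {n : ℕ} (u : ℝ) (L Y X : Matrix (Fin n) (Fin n) ℝ) : Prop :=
  ∀ i j, ∃ s, FlSubDot u (Y i j) (Finset.Iio i) (L i) (fun k => X k j) s ∧
    Rounded u (s / L i i) (X i j)

/-- Floating-point evaluation of `B - M Mᵀ` returns `S`: the matrix product is computed first by
inner products, and is then subtracted from `B`. -/
def FlSchur {n : ℕ} (u : ℝ) (B M S : Matrix (Fin n) (Fin n) ℝ) : Prop :=
  ∃ C : Matrix (Fin n) (Fin n) ℝ, (∀ i j, FlDot u (M i) (M j) (C i j)) ∧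
    ∀ i j, Rounded u (B i j - C i j) (S i j)

/-- Algorithm `W₂`, applied in floating point with machine precision `u` to the `2n × 2n` matrix
`A`, partitioned into `n × n` blocks, runs to completion and returns the block lower triangular
matrix `L`:
1. `A₁₁ = L₁₁ L₁₁ᵀ` (Cholesky);
2. `L₁₁ L₂₁ᵀ = A₁₂` (forward substitution);
3. `S = A₂₂ - L₂₁ L₂₁ᵀ` (Schur complement);
4. `S = L₂₂ L₂₂ᵀ` (reverse Cholesky). -/
def FlW2 {n : ℕ} (u : ℝ) (A L : Matrix (Fin n ⊕ Fin n) (Fin n ⊕ Fin n) ℝ) : Prop :=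
  ∃ L11 L21 S L22 : Matrix (Fin n) (Fin n) ℝ,
    FlCholesky u A.toBlocks₁₁ L11 ∧
    FlForwardSubst u L11 A.toBlocks₁₂ L21.transpose ∧
    FlSchur u A.toBlocks₂₂ L21 S ∧
    FlReverseCholesky u S L22 ∧
    L = Matrix.fromBlocks L11 0 L21 L22

/-- The entrywise absolute value `|A|` of a matrix. -/
def absMatrix {m : Type} (A : Matrix m m ℝ) : Matrix m m ℝ :=
  A.map fun x => |x|

/-- The spectral norm `‖A‖₂`, the operator norm for the Euclidean vector norm. -/
noncomputable def normTwo {m : Type} [Fintype m] [DecidableEq m] (A : Matrix m m ℝ) : ℝ :=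
  ‖Matrix.toEuclideanCLM (n := m) (𝕜 := ℝ) A‖

end FloatCholesky

namespace FloatCholesky

open Finset

/-! Every computed entry satisfies its defining equation exactly once each term is multiplied by a
factor near 1. Products and inverses of `1 + δ` combine by adding exponents (`NearOne`), and `k` of
them deviate from 1 by at most `γ_k`. Normalizing a sum so that the input entry has weight 1 leaves
all perturbation on the products, including the one containing the computed entry
(`FlSubDot.exists_weights`). The Schur complement adds only the error of one subtraction; the
computed `S` itself cancels when the two residuals of the last block are added.

For the norm bound, the diagonal of the entrywise bound controls the row norms of `L` by `√(A i i)`.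
Cauchy–Schwarz and positive definiteness then give `|E i j| ≤ c √(A i i) √(A j j)`, hence a spectral
norm at most `c` times the trace, and the trace is at most `2n‖A‖₂`. -/

/-- `r` deviates from `1` by no more than a product of `k` factors of the form `1 + δ` or
`(1 + δ)⁻¹` with `|δ| ≤ u`. -/
def NearOne (u : ℝ) (k : ℕ) (r : ℝ) : Prop :=
  (1 - u) ^ k ≤ r ∧ r ≤ ((1 - u) ^ k)⁻¹

/-! ### Accumulated rounding factors and `γ_k` -/

section NearOne

variable {u : ℝ} {k l : ℕ} {r s : ℝ}

theorem NearOne.pos (hu1 : u < 1) (h : NearOne u k r) : 0 < r :=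
  (pow_pos (sub_pos.2 hu1) k).trans_le h.1

theorem nearOne_one : NearOne u 0 1 := by simp [NearOne]

theorem NearOne.mono (hu : 0 ≤ u) (hu1 : u < 1) (h : NearOne u k r) (hkl : k ≤ l) :
    NearOne u l r := by
  have h1 : (1 - u) ^ l ≤ (1 - u) ^ k :=
    pow_le_pow_of_le_one (by linarith) (by linarith) hkl
  have h2 : 0 < (1 - u) ^ l := pow_pos (sub_pos.2 hu1) l
  exact ⟨h1.trans h.1, h.2.trans (inv_anti₀ h2 h1)⟩

theorem NearOne.mul (hu1 : u < 1) (hr : NearOne u k r) (hs : NearOne u l s) :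
    NearOne u (k + l) (r * s) := by
  have hk : 0 < (1 - u) ^ k := pow_pos (sub_pos.2 hu1) k
  have hl : 0 < (1 - u) ^ l := pow_pos (sub_pos.2 hu1) l
  refine ⟨?_, ?_⟩
  · rw [pow_add]
    exact mul_le_mul hr.1 hs.1 hl.le (hr.pos hu1).le
  · rw [pow_add, mul_inv]
    exact mul_le_mul hr.2 hs.2 (hs.pos hu1).le (inv_pos.2 hk).le

theorem NearOne.inv (hu1 : u < 1) (hr : NearOne u k r) : NearOne u k r⁻¹ := by
  have hk : 0 < (1 - u) ^ k := pow_pos (sub_pos.2 hu1) k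
  refine ⟨?_, inv_anti₀ hk hr.1⟩
  have := inv_anti₀ (hr.pos hu1) hr.2
  rwa [inv_inv] at this

theorem nearOne_one_add (hu1 : u < 1) {δ : ℝ} (hδ : |δ| ≤ u) : NearOne u 1 (1 + δ) := by
  obtain ⟨h1, h2⟩ := abs_le.1 hδ
  have h3 : 0 < 1 - u := sub_pos.2 hu1
  refine ⟨by rw [pow_one]; linarith, ?_⟩
  rw [pow_one, ← one_div, le_div_iff₀ h3]
  nlinarith [abs_nonneg δ]

theorem NearOne.abs_sub_one_le (hu : 0 ≤ u) (hku : (k : ℝ) * u < 1) (hu1 : u < 1)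
    (h : NearOne u k r) : |r - 1| ≤ gamma k u := by
  -- Bernoulli's inequality.
  have hb : 1 - k * u ≤ (1 - u) ^ k := by
    have := one_add_mul_le_pow (a := -u) (by linarith) k
    rw [← sub_eq_add_neg] at this
    linarith
  have h0 : 0 < 1 - k * u := by linarith
  have hku0 : 0 ≤ k * u := by positivity
  have hg : gamma k u = (1 - k * u)⁻¹ - 1 := by
    unfold gamma
    field_simp
    ring
  have h1 : r ≤ (1 - k * u)⁻¹ := h.2.trans (inv_anti₀ h0 hb)
  have h2 : k * u ≤ gamma k u := by
    unfold gamma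
    rw [le_div_iff₀ h0]
    nlinarith
  rw [abs_le]
  constructor <;> linarith [h.1]

end NearOne

theorem gamma_nonneg {k : ℕ} {u : ℝ} (hu : 0 ≤ u) (hku : (k : ℝ) * u < 1) : 0 ≤ gamma k u :=
  div_nonneg (by positivity) (by linarith)

theorem natCast_mul_lt_one_of_le {k l : ℕ} {u : ℝ} (hu : 0 ≤ u) (hlu : (l : ℝ) * u < 1)
    (hkl : k ≤ l) : (k : ℝ) * u < 1 :=
  (mul_le_mul_of_nonneg_right (Nat.cast_le.2 hkl) hu).trans_lt hlu

theorem gamma_mono {k l : ℕ} {u : ℝ} (hu : 0 ≤ u) (hlu : (l : ℝ) * u < 1) (hkl : k ≤ l) :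
    gamma k u ≤ gamma l u := by
  have h : (k : ℝ) * u ≤ l * u := mul_le_mul_of_nonneg_right (Nat.cast_le.2 hkl) hu
  exact div_le_div₀ (by positivity) h (by linarith) (by linarith)

theorem gamma_add_le_gamma_succ {k : ℕ} {u : ℝ} (hu : 0 ≤ u)
    (hku : ((k + 1 : ℕ) : ℝ) * u < 1) : gamma k u + u * (1 + gamma k u) ≤ gamma (k + 1) u := by
  have h1 : (k : ℝ) * u < 1 := natCast_mul_lt_one_of_le hu hku k.le_succ
  have h2 : 0 < 1 - (k : ℝ) * u := by linarith
  have h3 : 0 < 1 - ((k + 1 : ℕ) : ℝ) * u := by linarith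
  have h4 : gamma k u + u * (1 + gamma k u) = ((k + 1 : ℕ) : ℝ) * u / (1 - k * u) := by
    unfold gamma
    push_cast
    field_simp
    ring
  rw [h4]
  unfold gamma
  refine div_le_div_of_nonneg_left (by positivity) h3 ?_
  push_cast
  linarith

/-! ### Sums, inner products and single substitution steps -/

/-- A floating-point sum is an exact sum of terms with relative perturbations. The quotients of
two perturbations involve no more rounding errors than a single perturbation does, since the
errors made after both terms have been merged cancel. -/
theorem FlSum.exists_weights {ι : Type} [DecidableEq ι] {u : ℝ} (hu : 0 ≤ u) (hu1 : u < 1)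
    {x : ι → ℝ} {s : Finset ι} {z : ℝ} (h : FlSum u x s z) :
    1 ≤ s.card ∧ ∃ w : ι → ℝ, z = ∑ i ∈ s, x i * w i ∧
      (∀ i ∈ s, NearOne u (s.card - 1) (w i)) ∧
      ∀ i ∈ s, ∀ j ∈ s, NearOne u (s.card - 1) (w i * (w j)⁻¹) := by
  induction h with
  | single i => exact ⟨by simp, fun _ => 1, by simp, by simp [nearOne_one], by simp [nearOne_one]⟩
  | @add s t a b z hst ha hb hz iha ihb =>
    obtain ⟨hs, f, rfl, hf, hff⟩ := iha
    obtain ⟨ht, g, rfl, hg, hgg⟩ := ihb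
    obtain ⟨δ, hδ, rfl⟩ := hz
    have hδ' := nearOne_one_add hu1 hδ
    have hδ0 := hδ'.pos hu1
    have hcard := card_union_of_disjoint hst
    have hnot : ∀ i ∈ t, i ∉ s := fun i hi his => disjoint_left.1 hst his hi
    refine ⟨by omega, fun i => (if i ∈ s then f i else g i) * (1 + δ), ?_, ?_, ?_⟩
    · rw [sum_union hst, add_mul, sum_mul, sum_mul]
      congr 1
      · exact sum_congr rfl fun i hi => by simp only [if_pos hi]; ring
      · exact sum_congr rfl fun i hi => by simp only [if_neg (hnot i hi)]; ring
    · intro i hi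
      rcases mem_union.1 hi with hi | hi
      · simp only [if_pos hi]
        exact ((hf i hi).mul hu1 hδ').mono hu hu1 (by omega)
      · simp only [if_neg (hnot i hi)]
        exact ((hg i hi).mul hu1 hδ').mono hu hu1 (by omega)
    · intro i hi j hj
      have hcancel : ∀ p q : ℝ, p * (1 + δ) * (q * (1 + δ))⁻¹ = p * q⁻¹ := fun p q => by
        rw [← div_eq_mul_inv, mul_div_mul_right _ _ hδ0.ne', div_eq_mul_inv]
      rw [hcancel]
      rcases mem_union.1 hi with hi | hi <;> rcases mem_union.1 hj with hj | hj
      · rw [if_pos hi, if_pos hj]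
        exact (hff i hi j hj).mono hu hu1 (by omega)
      -- Terms from different halves share only the last rounding; the exponents `|s| - 1` and `|t|
      -- - 1` add up to less than `|s ∪ t| - 1`.
      · rw [if_pos hi, if_neg (hnot j hj)]
        exact ((hf i hi).mul hu1 ((hg j hj).inv hu1)).mono hu hu1 (by omega)
      · rw [if_neg (hnot i hi), if_pos hj]
        exact ((hg i hi).mul hu1 ((hf j hj).inv hu1)).mono hu hu1 (by omega)
      · rw [if_neg (hnot i hi), if_neg (hnot j hj)]
        exact (hgg i hi j hj).mono hu hu1 (by omega)

theorem abs_mul_sub_self_le {x w g : ℝ} (hw : |w - 1| ≤ g) : |x * w - x| ≤ g * |x| := by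
  rw [← mul_sub_one, abs_mul, mul_comm]
  exact mul_le_mul_of_nonneg_right hw (abs_nonneg x)

theorem FlDot.abs_sub_le {n : ℕ} {u : ℝ} (hu : 0 ≤ u) (hu1 : u < 1) (hn : (n : ℝ) * u < 1)
    {a b : Fin n → ℝ} {z : ℝ} (h : FlDot u a b z) :
    |z - ∑ k, a k * b k| ≤ gamma n u * ∑ k, |a k| * |b k| := by
  obtain ⟨p, hp, hsum⟩ := h
  obtain ⟨h1, w, rfl, hw, -⟩ := hsum.exists_weights hu hu1
  rw [card_univ, Fintype.card_fin] at h1 hw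
  rw [← sum_sub_distrib, mul_sum]
  refine (abs_sum_le_sum_abs _ _).trans (sum_le_sum fun k _ => ?_)
  obtain ⟨δ, hδ, hpk⟩ := hp k
  have hk : NearOne u n ((1 + δ) * w k) :=
    ((nearOne_one_add hu1 hδ).mul hu1 (hw k (mem_univ k))).mono hu hu1 (by omega)
  rw [hpk, mul_assoc, ← abs_mul]
  exact abs_mul_sub_self_le (hk.abs_sub_one_le hu hn hu1)

/-- Divide the weighted sum by the weight of `c`. The quotient bound on weights keeps the exponent
at `s.card`, and rounding each product adds one. -/
theorem FlSubDot.exists_weights {n : ℕ} {u : ℝ} (hu : 0 ≤ u) (hu1 : u < 1) {c : ℝ}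
    {s : Finset (Fin n)} {a b : Fin n → ℝ} {z : ℝ} (h : FlSubDot u c s a b z) :
    ∃ (v : ℝ) (w : Fin n → ℝ), z * v = c - ∑ k ∈ s, a k * b k * w k ∧
      NearOne u s.card v ∧ ∀ k ∈ s, NearOne u (s.card + 1) (w k) := by
  obtain ⟨p, hp, hsum⟩ := h
  obtain ⟨-, w, hz, hw, hww⟩ := hsum.exists_weights hu hu1
  rw [card_insertNone, Nat.add_sub_cancel] at hw hww
  have hnone : (none : Option (Fin n)) ∈ insertNone s := none_mem_insertNone
  have h0 : w none ≠ 0 := ((hw none hnone).pos hu1).ne'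
  choose! δ hδ hpk using hp
  refine ⟨(w none)⁻¹, fun k => (1 + δ k) * (w (some k) * (w none)⁻¹), ?_,
    (hw none hnone).inv hu1, fun k hk => ?_⟩
  · rw [hz, sum_insertNone]
    simp only [Option.elim_none, Option.elim_some]
    rw [add_mul, mul_assoc, mul_inv_cancel₀ h0, mul_one, sub_eq_add_neg, sum_mul,
      ← sum_neg_distrib]
    congr 1
    refine sum_congr rfl fun k hk => ?_
    rw [hpk k hk]
    ring
  · rw [add_comm]
    exact (nearOne_one_add hu1 (hδ k hk)).mul hu1
      (hww _ (some_mem_insertNone.2 hk) _ hnone)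

theorem abs_sub_sum_sub_le {ι : Type} {s : Finset ι} {x w : ι → ℝ} {c t v g : ℝ}
    (h : t * v = c - ∑ k ∈ s, x k * w k) (hv : |v - 1| ≤ g) (hw : ∀ k ∈ s, |w k - 1| ≤ g) :
    |c - (∑ k ∈ s, x k + t)| ≤ g * (∑ k ∈ s, |x k| + |t|) := by
  have h1 : c - (∑ k ∈ s, x k + t) = ∑ k ∈ s, (x k * w k - x k) + (t * v - t) := by
    rw [sum_sub_distrib, h]
    ring
  rw [h1, mul_add, mul_sum]
  refine (abs_add_le _ _).trans (add_le_add ?_ (abs_mul_sub_self_le hv))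
  exact (abs_sum_le_sum_abs _ _).trans (sum_le_sum fun k hk => abs_mul_sub_self_le (hw k hk))

/-- Backward error of one step of a substitution: `y` is the computed value of
`(c - ∑ k ∈ s, a k * b k) / d`. -/
theorem FlSubDot.div_abs_sub_le {n m : ℕ} {u : ℝ} (hu : 0 ≤ u) (hu1 : u < 1)
    (hm : (m : ℝ) * u < 1) {c : ℝ} {s : Finset (Fin n)} {a b : Fin n → ℝ} {z y d : ℝ}
    (h : FlSubDot u c s a b z) (hd : d ≠ 0) (hy : Rounded u (z / d) y) (hsm : s.card + 1 ≤ m) :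
    |c - (∑ k ∈ s, a k * b k + d * y)| ≤ gamma m u * (∑ k ∈ s, |a k| * |b k| + |d| * |y|) := by
  obtain ⟨v, w, hz, hv, hw⟩ := h.exists_weights hu hu1
  obtain ⟨δ, hδ, rfl⟩ := hy
  have hδ' := nearOne_one_add hu1 hδ
  have hδ0 := (hδ'.pos hu1).ne'
  -- The rounding of the quotient is absorbed into the weight of `d * y`.
  have hdy : d * (z / d * (1 + δ)) * ((1 + δ)⁻¹ * v) = c - ∑ k ∈ s, a k * b k * w k := by
    rw [← hz]
    field_simp
  simp only [← abs_mul]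
  refine abs_sub_sum_sub_le hdy ?_ fun k hk => ?_
  · exact (((hδ'.inv hu1).mul hu1 hv).mono hu hu1 (by omega)).abs_sub_one_le hu hm hu1
  · exact ((hw k hk).mono hu hu1 hsm).abs_sub_one_le hu hm hu1

/-- Backward error of the computation of a diagonal entry in the Cholesky factorization: `y` is
the computed value of `√(c - ∑ k ∈ s, a k * b k)`. -/
theorem FlSubDot.sqrt_abs_sub_le {n m : ℕ} {u : ℝ} (hu : 0 ≤ u) (hu1 : u < 1)
    (hm : (m : ℝ) * u < 1) {c : ℝ} {s : Finset (Fin n)} {a b : Fin n → ℝ} {z y : ℝ}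
    (h : FlSubDot u c s a b z) (hz0 : 0 < z) (hy : Rounded u (Real.sqrt z) y)
    (hsm : s.card + 2 ≤ m) :
    |c - (∑ k ∈ s, a k * b k + y * y)| ≤ gamma m u * (∑ k ∈ s, |a k| * |b k| + |y| * |y|) := by
  obtain ⟨v, w, hz, hv, hw⟩ := h.exists_weights hu hu1
  obtain ⟨δ, hδ, rfl⟩ := hy
  have hδ' := nearOne_one_add hu1 hδ
  have hδ0 := (hδ'.pos hu1).ne'
  -- Here `y` occurs squared, so the rounding of the root counts twice; this is why `s.card + 2` is
  -- needed.
  have hyy : Real.sqrt z * (1 + δ) * (Real.sqrt z * (1 + δ)) * ((1 + δ)⁻¹ * ((1 + δ)⁻¹ * v)) =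
      c - ∑ k ∈ s, a k * b k * w k := by
    rw [← hz]
    nth_rewrite 3 [← Real.mul_self_sqrt hz0.le]
    field_simp
  simp only [← abs_mul]
  refine abs_sub_sum_sub_le hyy ?_ fun k hk => ?_
  · exact (((hδ'.inv hu1).mul hu1 ((hδ'.inv hu1).mul hu1 hv)).mono hu hu1
      (by omega)).abs_sub_one_le hu hm hu1
  · exact ((hw k hk).mono hu hu1 (by omega)).abs_sub_one_le hu hm hu1

theorem sum_eq_sum_Iio_add {n : ℕ} (f : Fin n → ℝ) (j : Fin n) (h : ∀ k, j < k → f k = 0) :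
    ∑ k, f k = ∑ k ∈ Iio j, f k + f j := by
  rw [← sum_subset (subset_univ (Iic j)) fun k _ hk => h k (by simpa using hk), ← Iio_insert,
    sum_insert (by simp), add_comm]

/-! ### Componentwise backward error of the algorithm -/

section Algorithms

variable {n : ℕ} {u : ℝ}

theorem FlCholesky.diag_pos (hu1 : u < 1) {A L : Matrix (Fin n) (Fin n) ℝ}
    (h : FlCholesky u A L) (j : Fin n) : 0 < L j j := by
  obtain ⟨s, -, hs, δ, hδ, hL⟩ := h.diag j
  rw [hL]
  exact mul_pos (Real.sqrt_pos.2 hs) ((nearOne_one_add hu1 hδ).pos hu1)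

/-- At most `n - 1` products precede each entry, so off-diagonal entries need `γ_n` and only the
square roots need `γ_{n+1}`. -/
theorem FlCholesky.abs_sub_le (hu : 0 ≤ u) (hu1 : u < 1) (hn : ((n + 1 : ℕ) : ℝ) * u < 1)
    {A L : Matrix (Fin n) (Fin n) ℝ} (h : FlCholesky u A L) {i j : Fin n} (hij : j ≤ i) :
    |A i j - ∑ k, L i k * L j k| ≤ gamma (n + 1) u * ∑ k, |L i k| * |L j k| := by
  have hj := j.isLt
  rw [sum_eq_sum_Iio_add _ j fun k hk => by rw [h.upper j k hk, mul_zero],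
    sum_eq_sum_Iio_add _ j fun k hk => by rw [h.upper j k hk, abs_zero, mul_zero]]
  rcases hij.eq_or_lt with rfl | hij
  · obtain ⟨s, hs, hs0, hL⟩ := h.diag j
    exact hs.sqrt_abs_sub_le hu hu1 hn hs0 hL (by rw [Fin.card_Iio]; omega)
  · obtain ⟨s, hs, hL⟩ := h.lower i j hij
    rw [mul_comm (L i j), mul_comm |L i j|]
    exact hs.div_abs_sub_le hu hu1 hn (h.diag_pos hu1 j).ne' hL (by rw [Fin.card_Iio]; omega)

theorem FlReverseCholesky.abs_sub_le (hu : 0 ≤ u) (hu1 : u < 1)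
    (hn : ((n + 1 : ℕ) : ℝ) * u < 1) {A U : Matrix (Fin n) (Fin n) ℝ}
    (h : FlReverseCholesky u A U) {i j : Fin n} (hij : i ≤ j) :
    |A i j - ∑ k, U i k * U j k| ≤ gamma (n + 1) u * ∑ k, |U i k| * |U j k| := by
  have := FlCholesky.abs_sub_le hu hu1 hn h (i := i.rev) (j := j.rev) (Fin.rev_le_rev.2 hij)
  simp only [Matrix.submatrix_apply, Fin.rev_rev] at this
  have hsum : ∀ f : Fin n → ℝ, ∑ k : Fin n, f k.rev = ∑ k, f k := Equiv.sum_comp Fin.revPerm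
  rwa [hsum fun k => U i k * U j k, hsum fun k => |U i k| * |U j k|] at this

theorem FlForwardSubst.abs_sub_le (hu : 0 ≤ u) (hu1 : u < 1) (hn : (n : ℝ) * u < 1)
    {L Y X : Matrix (Fin n) (Fin n) ℝ} (h : FlForwardSubst u L Y X)
    (hL : ∀ i j, i < j → L i j = 0) (hL0 : ∀ i, L i i ≠ 0) (i j : Fin n) :
    |Y i j - ∑ k, L i k * X k j| ≤ gamma n u * ∑ k, |L i k| * |X k j| := by
  have hi := i.isLt
  rw [sum_eq_sum_Iio_add _ i fun k hk => by rw [hL i k hk, zero_mul],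
    sum_eq_sum_Iio_add _ i fun k hk => by rw [hL i k hk, abs_zero, zero_mul]]
  obtain ⟨s, hs, hX⟩ := h i j
  exact hs.div_abs_sub_le hu hu1 hn (hL0 i) hX (by rw [Fin.card_Iio]; omega)

theorem FlSchur.abs_sub_le (hu : 0 ≤ u) (hu1 : u < 1) (hn : ((n + 1 : ℕ) : ℝ) * u < 1)
    {B M S : Matrix (Fin n) (Fin n) ℝ} (h : FlSchur u B M S) (i j : Fin n) :
    |B i j - ∑ k, M i k * M j k - S i j| ≤
      u * |B i j| + gamma (n + 1) u * ∑ k, |M i k| * |M j k| := by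
  obtain ⟨C, hC, hS⟩ := h
  obtain ⟨δ, hδ, hSij⟩ := hS i j
  have hdot := (hC i j).abs_sub_le hu hu1 (natCast_mul_lt_one_of_le hu hn n.le_succ)
  have hsum : |∑ k, M i k * M j k| ≤ ∑ k, |M i k| * |M j k| := by
    simpa only [abs_mul] using abs_sum_le_sum_abs (fun k => M i k * M j k) univ
  have hT : 0 ≤ ∑ k, |M i k| * |M j k| := (abs_nonneg _).trans hsum
  set P := ∑ k, M i k * M j k
  set T := ∑ k, |M i k| * |M j k|
  have hCabs : |C i j| ≤ (1 + gamma n u) * T := by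
    have := abs_sub_abs_le_abs_sub (C i j) P
    linarith
  have hBC : |δ * (B i j - C i j)| ≤ u * (|B i j| + |C i j|) := by
    rw [abs_mul]
    exact mul_le_mul hδ (abs_sub _ _) (abs_nonneg _) hu
  have h1 : B i j - P - S i j = (C i j - P) - δ * (B i j - C i j) := by
    rw [hSij]
    ring
  rw [h1]
  refine (abs_sub _ _).trans ?_
  have h2 := mul_le_mul_of_nonneg_left hCabs hu
  have h3 := mul_le_mul_of_nonneg_right (gamma_add_le_gamma_succ hu hn) hT
  linarith

theorem FlW2.abs_sub_le (hu : 0 ≤ u) (hn : ((n + 1 : ℕ) : ℝ) * u < 1)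
    {A L : Matrix (Fin n ⊕ Fin n) (Fin n ⊕ Fin n) ℝ} (hA : ∀ i j, A i j = A j i)
    (h : FlW2 u A L) (i j : Fin n ⊕ Fin n) :
    |A i j - ∑ k, L i k * L j k| ≤
      u * |A i j| + gamma (n + 1) u * ∑ k, |L i k| * |L j k| := by
  -- An index exists, so `n ≥ 1`, and `u < 1` follows from the hypothesis on `(n + 1) u`.
  have hn0 : 1 ≤ n := by
    rcases i with i | i <;> have := i.isLt <;> omega
  have hu1 : u < 1 := by
    simpa using natCast_mul_lt_one_of_le (k := 1) hu hn (by omega)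
  have hn' : (n : ℝ) * u < 1 := natCast_mul_lt_one_of_le hu hn n.le_succ
  obtain ⟨L11, L21, S, L22, h11, h21, hS, h22, rfl⟩ := h
  have hsymm : ∀ i j, |A i j - ∑ k, Matrix.fromBlocks L11 0 L21 L22 i k *
        Matrix.fromBlocks L11 0 L21 L22 j k| ≤ u * |A i j| + gamma (n + 1) u *
        ∑ k, |Matrix.fromBlocks L11 0 L21 L22 i k| * |Matrix.fromBlocks L11 0 L21 L22 j k| →
      |A j i - ∑ k, Matrix.fromBlocks L11 0 L21 L22 j k *
        Matrix.fromBlocks L11 0 L21 L22 i k| ≤ u * |A j i| + gamma (n + 1) u *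
        ∑ k, |Matrix.fromBlocks L11 0 L21 L22 j k| *
          |Matrix.fromBlocks L11 0 L21 L22 i k| := by
    intro i j hij
    simpa only [hA j i, mul_comm] using hij
  have hdiag1 : ∀ i j, j ≤ i → |A (.inl i) (.inl j) -
      ∑ k, L11 i k * L11 j k| ≤ u * |A (.inl i) (.inl j)| +
        gamma (n + 1) u * ∑ k, |L11 i k| * |L11 j k| := by
    intro i j hij
    exact (h11.abs_sub_le hu hu1 hn hij).trans (le_add_of_nonneg_left (by positivity))
  have hoff : ∀ i j, |A (.inl i) (.inr j) - ∑ k, L11 i k * L21 j k| ≤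
      u * |A (.inl i) (.inr j)| + gamma (n + 1) u * ∑ k, |L11 i k| * |L21 j k| := by
    intro i j
    refine (h21.abs_sub_le hu hu1 hn' h11.upper (fun k => (h11.diag_pos hu1 k).ne') i j).trans ?_
    refine le_add_of_nonneg_of_le (by positivity) ?_
    exact mul_le_mul_of_nonneg_right (gamma_mono hu hn n.le_succ)
      (sum_nonneg fun k _ => by positivity)
  have hdiag2 : ∀ i j, i ≤ j → |A (.inr i) (.inr j) -
      (∑ k, L21 i k * L21 j k + ∑ k, L22 i k * L22 j k)| ≤ u * |A (.inr i) (.inr j)| +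
        gamma (n + 1) u * (∑ k, |L21 i k| * |L21 j k| + ∑ k, |L22 i k| * |L22 j k|) := by
    intro i j hij
    -- `S` cancels between the two residuals, and their bounds concern different blocks of `L`, so
    -- `γ_{n+1}` is not doubled.
    have h1 := hS.abs_sub_le hu hu1 hn i j
    have h2 := h22.abs_sub_le hu hu1 hn hij
    have h3 := abs_add_le (A.toBlocks₂₂ i j - ∑ k, L21 i k * L21 j k - S i j)
      (S i j - ∑ k, L22 i k * L22 j k)
    rw [sub_add_sub_cancel, sub_sub] at h3
    rw [mul_add, ← add_assoc]
    exact h3.trans (add_le_add h1 h2)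
  rcases i with i | i <;> rcases j with j | j
  · rcases le_total j i with hij | hij
    · simpa [Fintype.sum_sum_type] using hdiag1 i j hij
    · exact hsymm _ _ (by simpa [Fintype.sum_sum_type] using hdiag1 j i hij)
  · simpa [Fintype.sum_sum_type] using hoff i j
  · exact hsymm _ _ (by simpa [Fintype.sum_sum_type] using hoff j i)
  · rcases le_total i j with hij | hij
    · simpa [Fintype.sum_sum_type] using hdiag2 i j hij
    · exact hsymm _ _ (by simpa [Fintype.sum_sum_type] using hdiag2 j i hij)

end Algorithms

/-! ### From entrywise bounds to the spectral norm -/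

theorem abs_apply_le_sqrt_mul_sqrt {m : Type} {A : Matrix m m ℝ} (hA : A.PosDef) (i j : m) :
    |A i j| ≤ Real.sqrt (A i i) * Real.sqrt (A j j) := by
  -- Semidefiniteness of the 2×2 submatrix suffices, and survives `i = j`.
  have hdet := (hA.posSemidef.submatrix ![i, j]).det_nonneg
  have hji : A j i = A i j := by simpa using hA.isHermitian.apply i j
  rw [Matrix.det_fin_two] at hdet
  simp only [Matrix.submatrix_apply, Matrix.cons_val_zero, Matrix.cons_val_one, hji] at hdet
  rw [← Real.sqrt_mul hA.diag_pos.le]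
  refine Real.abs_le_sqrt ?_
  rw [pow_two]
  linarith

theorem sum_abs_mul_abs_le_sqrt_mul_sqrt {m : Type} [Fintype m] (L : Matrix m m ℝ)
    (i j : m) :
    ∑ k, |L i k| * |L j k| ≤
      Real.sqrt (∑ k, L i k * L i k) * Real.sqrt (∑ k, L j k * L j k) := by
  have := Real.sum_mul_le_sqrt_mul_sqrt univ (fun k => |L i k|) fun k => |L j k|
  simpa only [sq_abs, pow_two, abs_mul_abs_self] using this

section SpectralNorm

variable {m : Type} [Fintype m] [DecidableEq m]

/-- Cauchy–Schwarz in each row: in effect the Frobenius norm bounds the spectral norm. -/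
theorem normTwo_le_of_abs_le {E : Matrix m m ℝ} {c : ℝ} (hc : 0 ≤ c) {d : m → ℝ}
    (h : ∀ i j, |E i j| ≤ c * (d i * d j)) : normTwo E ≤ c * ∑ i, d i ^ 2 := by
  have hD : 0 ≤ ∑ i, d i ^ 2 := sum_nonneg fun i _ => sq_nonneg _
  refine ContinuousLinearMap.opNorm_le_bound _ (by positivity) fun x => ?_
  refine le_of_sq_le_sq ?_ (by positivity)
  rw [mul_pow, EuclideanSpace.real_norm_sq_eq, EuclideanSpace.real_norm_sq_eq]
  have hrow : ∀ i, (Matrix.toEuclideanCLM (n := m) (𝕜 := ℝ) E x) i ^ 2 ≤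
      ((c ^ 2 * ∑ j, d j ^ 2) * ∑ j, x j ^ 2) * d i ^ 2 := by
    intro i
    have h1 : (Matrix.toEuclideanCLM (n := m) (𝕜 := ℝ) E x) i = ∑ j, E i j * x j := by
      simp [Matrix.ofLp_toEuclideanCLM, Matrix.mulVec, dotProduct]
    have h2 : (∑ j, E i j * x j) ^ 2 ≤ (∑ j, E i j ^ 2) * ∑ j, x j ^ 2 :=
      sum_mul_sq_le_sq_mul_sq _ _ _
    have h3 : ∑ j, E i j ^ 2 ≤ (c ^ 2 * ∑ j, d j ^ 2) * d i ^ 2 := by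
      rw [mul_sum, sum_mul]
      refine sum_le_sum fun j _ => ?_
      calc E i j ^ 2 = |E i j| ^ 2 := (sq_abs _).symm
        _ ≤ (c * (d i * d j)) ^ 2 := pow_le_pow_left₀ (abs_nonneg _) (h i j) 2
        _ = _ := by ring
    rw [h1]
    refine h2.trans ((mul_le_mul_of_nonneg_right h3 (sum_nonneg fun j _ => sq_nonneg _)).trans_eq ?_)
    ring
  refine (sum_le_sum fun i _ => hrow i).trans_eq ?_
  rw [← mul_sum]
  ring

theorem apply_self_le_normTwo (A : Matrix m m ℝ) (i : m) : A i i ≤ normTwo A := by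
  have h1 : (Matrix.toEuclideanCLM (n := m) (𝕜 := ℝ) A (EuclideanSpace.single i 1)) i = A i i := by
    simp [Matrix.ofLp_toEuclideanCLM]
  have h2 := PiLp.norm_apply_le
    (Matrix.toEuclideanCLM (n := m) (𝕜 := ℝ) A (EuclideanSpace.single i 1)) i
  have h3 := (Matrix.toEuclideanCLM (n := m) (𝕜 := ℝ) A).le_opNorm (EuclideanSpace.single i 1)
  rw [h1, Real.norm_eq_abs] at h2
  rw [PiLp.norm_single, norm_one, mul_one] at h3
  exact (le_abs_self _).trans (h2.trans h3)

/-- A perturbation of a positive definite matrix `A` to `L Lᵀ` that is small relative to `|A|` and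
`|L| |L|ᵀ` is small relative to the trace of `A`. -/
theorem normTwo_sub_le {A L : Matrix m m ℝ} (hA : A.PosDef) {u g : ℝ} (hu : 0 ≤ u) (hg : 0 ≤ g)
    (hg1 : g < 1)
    (h : ∀ i j, |A i j - ∑ k, L i k * L j k| ≤ u * |A i j| + g * ∑ k, |L i k| * |L j k|) :
    normTwo (A - L * L.transpose) ≤ (u + g * ((1 + u) / (1 - g))) * ∑ i, A i i := by
  have hg1' : 0 < 1 - g := by linarith
  set q := (1 + u) / (1 - g)
  have hq : 0 ≤ q := div_nonneg (by linarith) hg1'.le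
  have hdiag : ∀ i, 0 < A i i := fun i => hA.diag_pos
  -- On the diagonal the sum on the right is the squared row norm itself, so it can be moved to the
  -- left.
  have hrow : ∀ i, ∑ k, L i k * L i k ≤ q * A i i := by
    intro i
    have h1 := (abs_le.1 (h i i)).1
    simp only [abs_mul_abs_self, abs_of_pos (hdiag i)] at h1
    rw [div_mul_eq_mul_div, le_div_iff₀ hg1']
    linarith
  have hsq : ∑ i, A i i = ∑ i, Real.sqrt (A i i) ^ 2 :=
    sum_congr rfl fun i _ => (Real.sq_sqrt (hdiag i).le).symm
  rw [hsq]
  refine normTwo_le_of_abs_le (by positivity) fun i j => ?_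
  have h2 : ∑ k, |L i k| * |L j k| ≤ q * (Real.sqrt (A i i) * Real.sqrt (A j j)) := by
    refine (sum_abs_mul_abs_le_sqrt_mul_sqrt L i j).trans ?_
    refine (mul_le_mul (Real.sqrt_le_sqrt (hrow i)) (Real.sqrt_le_sqrt (hrow j))
      (Real.sqrt_nonneg _) (Real.sqrt_nonneg _)).trans_eq ?_
    rw [Real.sqrt_mul hq, Real.sqrt_mul hq, mul_mul_mul_comm, Real.mul_self_sqrt hq]
  have h3 : (A - L * L.transpose) i j = A i j - ∑ k, L i k * L j k := by
    simp [Matrix.mul_apply]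
  rw [h3]
  refine (h i j).trans ?_
  have h4 := mul_le_mul_of_nonneg_left (abs_apply_le_sqrt_mul_sqrt hA i j) hu
  have h5 := mul_le_mul_of_nonneg_left h2 hg
  linarith

end SpectralNorm

theorem perturbation_constant_le {n : ℕ} (hn0 : 1 ≤ n) {u : ℝ} (hu : 0 ≤ u)
    (hn : ((n + 2 : ℕ) : ℝ) * u < 1) (h4 : 4 * (n : ℝ) * gamma (n + 2) u < 1) :
    gamma (n + 1) u < 1 ∧
      u + gamma (n + 1) u * ((1 + u) / (1 - gamma (n + 1) u)) ≤ 2 * gamma (n + 2) u := by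
  have hn1 : (1 : ℝ) ≤ n := by exact_mod_cast hn0
  have hpos : 0 < 1 - ((n + 2 : ℕ) : ℝ) * u := by linarith
  have hg2 : 0 ≤ gamma (n + 2) u := gamma_nonneg hu hn
  have hlt : 4 * gamma (n + 2) u < 1 := by nlinarith
  -- Clearing the denominator in `4 γ_{n+2} < 1`.
  have hx : 5 * (((n + 2 : ℕ) : ℝ) * u) < 1 := by
    unfold gamma at hlt
    rw [← mul_div_assoc, div_lt_one hpos] at hlt
    linarith
  have hle : ((n + 2 : ℕ) : ℝ) * u ≤ gamma (n + 2) u := by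
    unfold gamma
    rw [le_div_iff₀ hpos]
    nlinarith [mul_nonneg (Nat.cast_nonneg (α := ℝ) (n + 2)) hu]
  have hgm : gamma (n + 1) u ≤ gamma (n + 2) u := gamma_mono hu hn (by omega)
  have hg1 : gamma (n + 1) u < 1 := by linarith
  refine ⟨hg1, ?_⟩
  push_cast at hx hle
  have hnu : 0 ≤ (n : ℝ) * u := by positivity
  have hnu' : u ≤ (n : ℝ) * u := le_mul_of_one_le_left hu hn1
  have hden : 0 < 1 - ((n + 1 : ℕ) : ℝ) * u := by push_cast; linarith
  have hden2 : 0 < 1 - 2 * (((n + 1 : ℕ) : ℝ) * u) := by push_cast; linarith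
  -- `γ_k / (1 - γ_k) = k u / (1 - 2 k u)`. With the next factor at most 2, the total is at most
  -- `(2n + 3) u`, below `2 (n + 2) u`.
  have heq : gamma (n + 1) u * ((1 + u) / (1 - gamma (n + 1) u)) =
      ((n + 1 : ℕ) : ℝ) * u * ((1 + u) / (1 - 2 * (((n + 1 : ℕ) : ℝ) * u))) := by
    have h1 : 1 - gamma (n + 1) u =
        (1 - 2 * (((n + 1 : ℕ) : ℝ) * u)) / (1 - ((n + 1 : ℕ) : ℝ) * u) := by
      unfold gamma
      rw [eq_div_iff hden.ne', sub_mul, div_mul_cancel₀ _ hden.ne']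
      ring
    rw [h1]
    unfold gamma
    field_simp
  have hfac : (1 + u) / (1 - 2 * (((n + 1 : ℕ) : ℝ) * u)) ≤ 2 := by
    rw [div_le_iff₀ hden2]
    push_cast
    linarith
  have := mul_le_mul_of_nonneg_left hfac
    (show 0 ≤ ((n + 1 : ℕ) : ℝ) * u by positivity)
  rw [heq]
  push_cast at this ⊢
  linarith

end FloatCholesky

theorem mainTheorem1 (n : ℕ) (u : ℝ) (hu : 0 ≤ u)
    (A : Matrix (Fin n ⊕ Fin n) (Fin n ⊕ Fin n) ℝ) (hA : A.PosDef)
    (L : Matrix (Fin n ⊕ Fin n) (Fin n ⊕ Fin n) ℝ) (hL : FloatCholesky.FlW2 u A L)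
    (hn : ((n + 1 : ℕ) : ℝ) * u < 1) :
    ∃ E : Matrix (Fin n ⊕ Fin n) (Fin n ⊕ Fin n) ℝ,
      A + E = L * L.transpose ∧
      (∀ i j, FloatCholesky.absMatrix E i j ≤
        (u • FloatCholesky.absMatrix A + FloatCholesky.gamma (n + 1) u •
          (FloatCholesky.absMatrix L * FloatCholesky.absMatrix L.transpose)) i j) ∧
      (((n + 2 : ℕ) : ℝ) * u < 1 → 4 * (n : ℝ) * FloatCholesky.gamma (n + 2) u < 1 →
        FloatCholesky.normTwo (A - L * L.transpose) = FloatCholesky.normTwo E ∧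
        FloatCholesky.normTwo E ≤
          4 * (n : ℝ) * FloatCholesky.gamma (n + 2) u * FloatCholesky.normTwo A) := by
  open FloatCholesky in
  have hsymm : ∀ i j, A i j = A j i := fun i j => by simpa using hA.isHermitian.apply j i
  have hentry := hL.abs_sub_le hu hn hsymm
  have hnorm : normTwo (A - L * L.transpose) = normTwo (L * L.transpose - A) := by
    unfold normTwo
    rw [← neg_sub, map_neg, norm_neg]
  refine ⟨L * L.transpose - A, by abel, fun i j => ?_, fun hn2 h4 => ⟨hnorm, ?_⟩⟩
  · have h := hentry i j
    rw [abs_sub_comm] at h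
    simpa [absMatrix, Matrix.mul_apply] using h
  rw [← hnorm]
  -- For `n = 0` the smallness hypothesis on `4 n γ_{n+2}` is void, but the matrices are empty.
  rcases Nat.eq_zero_or_pos n with rfl | hn0
  · have : A - L * L.transpose = 0 := by
      ext i
      rcases i with i | i <;> exact i.elim0
    rw [this]
    simp [normTwo]
  obtain ⟨hg1, hc⟩ := perturbation_constant_le hn0 hu hn2 h4
  have hg2 := gamma_nonneg hu hn2
  have htr : ∑ i, A i i ≤ 2 * n * normTwo A := by
    refine (Finset.sum_le_sum fun i _ => apply_self_le_normTwo A i).trans_eq ?_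
    rw [Finset.sum_const, Finset.card_univ, Fintype.card_sum, Fintype.card_fin, nsmul_eq_mul]
    push_cast
    ring
  have htr0 : 0 ≤ ∑ i, A i i := Finset.sum_nonneg fun i _ => hA.diag_pos.le
  calc normTwo (A - L * L.transpose)
      ≤ (u + gamma (n + 1) u * ((1 + u) / (1 - gamma (n + 1) u))) * ∑ i, A i i :=
        normTwo_sub_le hA hu (gamma_nonneg hu hn) hg1 hentry
    _ ≤ 2 * gamma (n + 2) u * (2 * n * normTwo A) := mul_le_mul hc htr htr0 (by positivity)
    _ = _ := by ring
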